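/- Let $n\ge 0$, let $\mathbf{L}_n$ be the free Lie algebra over $\mathbb{Z}$ on $n$ generators $x_1,\dots,x_n$, graded by bracket length (so that each generator has degree $1$, and the degree $k$ piece is the subgroup spanned by all iterated brackets of exactly $k$ generators), and let $\mathbf{L}_n''=[[\mathbf{L}_n,\mathbf{L}_n],[\mathbf{L}_n,\mathbf{L}_n]]$ be its second derived ideal. For $k\ge 0$ let $M_k$ be the image in $\mathbf{L}_n/\mathbf{L}_n''$ of the degree $k$ piece of $\mathbf{L}_n$. Then $\mathbf{L}_n/\mathbf{L}_n''$ is a free abelian group, it is graded by the subgroups $M_k$, that is, $\mathbf{L}_n/\mathbf{L}_n''=\bigoplus_{k\ge 0}M_k$, each $M_k$ is a free abelian group of finite rank, and the Hilbert series is $$\operatorname{Hilb}(\mathbf{L}_n/\mathbf{L}_n'',t):=\sum_{k\ge 0}\operatorname{rank}(M_k)\,t^k = nt+\sum_{k\ge 2}(k-1)\binom{n+k-2}{k}t^k .$$ -/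

import Mathlib

/-- `IsBracketMonomial n k x`: the element `x` of the free `ℤ`-Lie algebra on the generators
`x_0, …, x_{n-1}` is an iterated bracket, with any parenthesization, of exactly `k` generators. -/
inductive IsBracketMonomial (n : ℕ) : ℕ → FreeLieAlgebra ℤ (Fin n) → Prop
  | of (i : Fin n) : IsBracketMonomial n 1 (FreeLieAlgebra.of ℤ i)
  | lie {k l : ℕ} {x y : FreeLieAlgebra ℤ (Fin n)} :
      IsBracketMonomial n k x → IsBracketMonomial n l y → IsBracketMonomial n (k + l) ⁅x, y⁆

/-- The degree `k` piece of the free `ℤ`-Lie algebra on `n` generators of degree `1`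
(the grading by bracket length). -/
noncomputable def freeLieDegree (n k : ℕ) : Submodule ℤ (FreeLieAlgebra ℤ (Fin n)) :=
  Submodule.span ℤ {x | IsBracketMonomial n k x}

/-- The free metabelian Lie algebra `L_n / L_n''` over `ℤ`: the quotient of the free Lie algebra
`L_n` on `n` generators by its second derived ideal `L_n'' = ⁅⁅L_n, L_n⁆, ⁅L_n, L_n⁆⁆`. -/
abbrev FreeMetabelianLie (n : ℕ) : Type :=
  FreeLieAlgebra ℤ (Fin n) ⧸ LieAlgebra.derivedSeries ℤ (FreeLieAlgebra ℤ (Fin n)) 2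

/-- The degree `k` piece of `L_n / L_n''`: the image of the degree `k` piece of `L_n`. -/
noncomputable def freeMetabelianDegree (n k : ℕ) : Submodule ℤ (FreeMetabelianLie n) :=
  (freeLieDegree n k).map
    (LieSubmodule.Quotient.mk'
      (LieAlgebra.derivedSeries ℤ (FreeLieAlgebra ℤ (Fin n)) 2)).toLinearMap

/-- The Hilbert series `∑ₖ rank(A k) tᵏ` of a family of subgroups. It is meaningful when every
`A k` is finitely generated. -/
noncomputable def hilbertSeries {M : Type*} [AddCommGroup M] [Module ℤ M]
    (A : ℕ → Submodule ℤ M) : PowerSeries ℤ :=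
  PowerSeries.mk fun k => (Module.finrank ℤ (A k) : ℤ)

section BasicElements

variable {ι L : Type*} [LieRing L] (y : ι → L)

/-- The iterated bracket `⁅y i₁, ⁅y i₂, … ⁅y iₖ, u⁆ … ⁆⁆` for `l = [i₁, …, iₖ]`. -/
def iteratedLie (l : List ι) (u : L) : L :=
  l.foldr (fun i w => ⁅y i, w⁆) u

@[simp] theorem iteratedLie_nil (u : L) : iteratedLie y [] u = u := rfl

@[simp] theorem iteratedLie_cons (i : ι) (l : List ι) (u : L) :
    iteratedLie y (i :: l) u = ⁅y i, iteratedLie y l u⁆ := rfl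

theorem iteratedLie_append (l₁ l₂ : List ι) (u : L) :
    iteratedLie y (l₁ ++ l₂) u = iteratedLie y l₁ (iteratedLie y l₂ u) := by
  simp [iteratedLie]

theorem iteratedLie_sub (l : List ι) (u w : L) :
    iteratedLie y l (u - w) = iteratedLie y l u - iteratedLie y l w := by
  induction l with
  | nil => simp
  | cons i l ih => simp [ih]

theorem iteratedLie_neg (l : List ι) (u : L) :
    iteratedLie y l (-u) = -iteratedLie y l u := by
  induction l with
  | nil => simp
  | cons i l ih => simp [ih]

theorem iteratedLie_zero (l : List ι) : iteratedLie y l (0 : L) = 0 := by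
  induction l with
  | nil => simp
  | cons i l ih => simp [ih]

theorem exists_iteratedLie_eq_lie (l : List ι) (c d : L) :
    ∃ a b : L, iteratedLie y l ⁅c, d⁆ = ⁅a, b⁆ := by
  cases l with
  | nil => exact ⟨c, d, rfl⟩
  | cons i l => exact ⟨y i, iteratedLie y l ⁅c, d⁆, rfl⟩

theorem iteratedLie_perm (h : ∀ a b c d : L, ⁅⁅a, b⁆, ⁅c, d⁆⁆ = 0) {l₁ l₂ : List ι}
    (hl : l₁.Perm l₂) (c d : L) : iteratedLie y l₁ ⁅c, d⁆ = iteratedLie y l₂ ⁅c, d⁆ := by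
  induction hl with
  | nil => rfl
  | cons i _ ih => simp [ih]
  | swap i j l =>
    obtain ⟨a, b, hab⟩ := exists_iteratedLie_eq_lie y l c d
    simp only [iteratedLie_cons, hab]
    rw [leibniz_lie (y j) (y i), h, zero_add]
  | trans _ _ ih₁ ih₂ => exact ih₁.trans ih₂

/-- Indices `(p, j, s)` of the basic brackets `ad(y_s) ⁅y p, y j⁆` of degree at least two of a
free metabelian Lie algebra: `p < j`, and `p` is at most every member of the multiset `s`. -/
abbrev BasicTriple (ι : Type*) [LinearOrder ι] : Type _ :=
  {x : ι × ι × Multiset ι // x.1 < x.2.1 ∧ ∀ a ∈ x.2.2, x.1 ≤ a}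

variable [LinearOrder ι]

/-- The basic elements: the generators `y i` and the brackets `ad(y_s) ⁅y p, y j⁆`. -/
noncomputable def basicElement : ι ⊕ BasicTriple ι → L
  | .inl i => y i
  | .inr x => iteratedLie y x.1.2.2.toList ⁅y x.1.1, y x.1.2.1⁆

/-- The bracket length of a basic element. -/
def basicDegree : ι ⊕ BasicTriple ι → ℕ
  | .inl _ => 1
  | .inr x => Multiset.card x.1.2.2 + 2

/-- The span of the basic elements of degree `k`. -/
noncomputable def basicSpan (k : ℕ) : AddSubgroup L :=
  AddSubgroup.closure (basicElement y '' (basicDegree ⁻¹' {k}))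

theorem basicElement_mem_basicSpan (x : ι ⊕ BasicTriple ι) :
    basicElement y x ∈ basicSpan y (basicDegree x) :=
  AddSubgroup.subset_closure ⟨x, rfl, rfl⟩

variable {y}

theorem iteratedLie_mem_basicSpan_of_le (h : ∀ a b c d : L, ⁅⁅a, b⁆, ⁅c, d⁆⁆ = 0)
    {l : List ι} {p j : ι} (hj : p ≤ j)
    (hl : ∀ a ∈ l, p ≤ a) : iteratedLie y l ⁅y p, y j⁆ ∈ basicSpan y (l.length + 2) := by
  rcases hj.eq_or_lt with rfl | hj
  · simp [iteratedLie_zero, zero_mem]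
  · have := basicElement_mem_basicSpan y (.inr ⟨(p, j, (l : Multiset ι)), hj, by simpa using hl⟩)
    simp only [basicElement, basicDegree, Multiset.coe_card] at this
    rwa [iteratedLie_perm y h (l₁ := Multiset.toList (l : Multiset ι)) (l₂ := l)] at this
    rw [← Multiset.coe_eq_coe, Multiset.coe_toList]

theorem iteratedLie_mem_basicSpan (h : ∀ a b c d : L, ⁅⁅a, b⁆, ⁅c, d⁆⁆ = 0)
    (l : List ι) (i j : ι) :
    iteratedLie y l ⁅y i, y j⁆ ∈ basicSpan y (l.length + 2) := by
  obtain ⟨p, hp, hle⟩ : ∃ p ∈ i :: j :: l, ∀ a ∈ i :: j :: l, p ≤ a := by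
    have hne : (i :: j :: l).toFinset.Nonempty := ⟨i, by simp⟩
    exact ⟨_, List.mem_toFinset.1 (Finset.min'_mem _ hne),
      fun a ha => Finset.min'_le _ a (List.mem_toFinset.2 ha)⟩
  simp only [List.mem_cons, forall_eq_or_imp] at hp hle
  obtain ⟨hi, hj, hl⟩ := hle
  rcases hp with rfl | rfl | hp
  · exact iteratedLie_mem_basicSpan_of_le h hj hl
  · rw [← lie_skew, iteratedLie_neg]
    exact neg_mem (iteratedLie_mem_basicSpan_of_le h hi hl)
  · have hperm : l.Perm (l.erase p ++ [p]) :=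
      (List.perm_cons_erase hp).trans (List.perm_append_singleton p _).symm
    have hlen : (l.erase p).length + 1 = l.length := by
      simpa using hperm.length_eq.symm
    have jacobi : ⁅y p, ⁅y i, y j⁆⁆ = ⁅y i, ⁅y p, y j⁆⁆ - ⁅y j, ⁅y p, y i⁆⁆ := by
      rw [leibniz_lie (y p), ← lie_skew (y j) ⁅y p, y i⁆]; abel
    have hl' : ∀ a ∈ l.erase p, p ≤ a := fun a ha => hl a (List.mem_of_mem_erase ha)
    have key : ∀ a b, p ≤ a → p ≤ b →
        iteratedLie y (l.erase p ++ [a]) ⁅y p, y b⁆ ∈ basicSpan y (l.length + 2) := by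
      intro a b ha hb
      have := iteratedLie_mem_basicSpan_of_le (y := y) h (l := l.erase p ++ [a]) hb
        (by simpa [or_imp, forall_and, ha] using hl')
      simpa [hlen] using this
    rw [iteratedLie_perm y h hperm, iteratedLie_append, iteratedLie_cons, iteratedLie_nil, jacobi,
      iteratedLie_sub]
    simpa [iteratedLie_append] using sub_mem (key i j hi hj) (key j i hj hi)

theorem lie_mem_basicSpan (h : ∀ a b c d : L, ⁅⁅a, b⁆, ⁅c, d⁆⁆ = 0)
    {k l : ℕ} {u w : L} (hu : u ∈ basicSpan y k) (hw : w ∈ basicSpan y l) :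
    ⁅u, w⁆ ∈ basicSpan y (k + l) := by
  induction hu using AddSubgroup.closure_induction with
  | zero => simp [zero_mem]
  | add _ _ _ _ h₁ h₂ => simpa using add_mem h₁ h₂
  | neg _ _ h₁ => rw [neg_lie]; exact neg_mem h₁
  | mem u hu =>
  induction hw using AddSubgroup.closure_induction with
  | zero => simp [zero_mem]
  | add _ _ _ _ h₁ h₂ => simpa using add_mem h₁ h₂
  | neg _ _ h₁ => rw [lie_neg]; exact neg_mem h₁
  | mem w hw =>
    obtain ⟨a, rfl, rfl⟩ := hu
    obtain ⟨b, rfl, rfl⟩ := hw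
    have key : ∀ (i : ι) (x : BasicTriple ι), ⁅y i, basicElement y (.inr x)⁆ ∈
        basicSpan y (1 + basicDegree (.inr x)) := by
      intro i x
      have := iteratedLie_mem_basicSpan (y := y) h (i :: x.1.2.2.toList) x.1.1 x.1.2.1
      rw [iteratedLie_cons, List.length_cons, Multiset.length_toList] at this
      have e : 1 + basicDegree (.inr x) = Multiset.card x.1.2.2 + 1 + 2 := by
        simp only [basicDegree]; ring
      rw [e]
      exact this
    rcases a with i | a <;> rcases b with j | b
    · exact iteratedLie_mem_basicSpan h [] i j
    · exact key i b
    · rw [← lie_skew, add_comm]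
      exact neg_mem (key j a)
    · obtain ⟨c, d, hcd⟩ := exists_iteratedLie_eq_lie y a.1.2.2.toList (y a.1.1) (y a.1.2.1)
      obtain ⟨e, f, hef⟩ := exists_iteratedLie_eq_lie y b.1.2.2.toList (y b.1.1) (y b.1.2.1)
      simp only [basicElement, hcd, hef, h, zero_mem]

end BasicElements

section BasicCount

/-- Basic triples of degree `k + 2`, sorted by their smallest index. -/
noncomputable def basicTripleEquiv (n k : ℕ) :
    (Σ p : Fin n, {j : Fin n // p < j} × Sym {a : Fin n // p ≤ a} k) ≃
      {x : BasicTriple (Fin n) // Multiset.card x.1.2.2 = k} :=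
  Equiv.ofBijective
    (fun x => ⟨⟨(x.1, x.2.1.1, x.2.2.1.map Subtype.val), x.2.1.2, by
      intro a ha
      obtain ⟨b, -, rfl⟩ := Multiset.mem_map.1 ha
      exact b.2⟩, by simp⟩) (by
    constructor
    · rintro ⟨p, ⟨j, hj⟩, s⟩ ⟨p', ⟨j', hj'⟩, s'⟩ hxy
      simp only [Subtype.mk.injEq, Prod.mk.injEq] at hxy
      obtain ⟨rfl, rfl, hs⟩ := hxy
      have : s = s' := Subtype.ext (Multiset.map_injective Subtype.val_injective hs)
      rw [this]
    · rintro ⟨⟨⟨p, j, s⟩, hj, hs⟩, hk⟩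
      lift s to Multiset {a : Fin n // p ≤ a} using hs
      exact ⟨⟨p, ⟨j, hj⟩, ⟨s, by simpa using hk⟩⟩, rfl⟩)

theorem sum_range_mul_choose (n k : ℕ) :
    ∑ q ∈ Finset.range n, q * Nat.choose (q + k) k = (k + 1) * Nat.choose (n + k) (k + 2) := by
  induction n with
  | zero => simp [Nat.choose_eq_zero_of_lt]
  | succ n ih =>
    have h := Nat.choose_succ_right_eq (n + k) k
    rw [Nat.add_sub_cancel_right] at h
    rw [Finset.sum_range_succ, ih, Nat.add_right_comm n 1 k, Nat.choose_succ_succ' (n + k) (k + 1)]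
    linarith

theorem card_basicTriple (n k : ℕ) :
    Nat.card {x : BasicTriple (Fin n) // Multiset.card x.1.2.2 = k} =
      (k + 1) * Nat.choose (n + k) (k + 2) := by
  rw [← Nat.card_congr (basicTripleEquiv n k), Nat.card_eq_fintype_card, Fintype.card_sigma,
    ← sum_range_mul_choose, ← Fin.sum_univ_eq_sum_range (fun q => q * Nat.choose (q + k) k),
    ← Equiv.sum_comp Fin.revPerm]
  refine Finset.sum_congr rfl fun p _ => ?_
  have h₁ : Fintype.card {j : Fin n // Fin.rev p < j} = p := by
    rw [Fintype.card_subtype, Finset.filter_lt_eq_Ioi, Fin.card_Ioi, Fin.val_rev]; omega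
  have h₂ : Fintype.card {j : Fin n // Fin.rev p ≤ j} = p + 1 := by
    rw [Fintype.card_subtype, Finset.filter_le_eq_Ici, Fin.card_Ici, Fin.val_rev]; omega
  rw [Fintype.card_prod, Sym.card_sym_eq_choose, Fin.revPerm_apply, h₁, h₂]
  congr 2
  omega

theorem finite_basicTriple (n k : ℕ) :
    Finite {x : BasicTriple (Fin n) // Multiset.card x.1.2.2 = k} :=
  .of_equiv _ (basicTripleEquiv n k)

/-- The basic indices of degree `k + 2` are the basic triples whose multiset has `k` elements. -/
def basicDegreeFiberEquiv (n k : ℕ) :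
    {x : BasicTriple (Fin n) // Multiset.card x.1.2.2 = k} ≃
      (basicDegree (ι := Fin n) ⁻¹' {k + 2} : Set _) where
  toFun x := ⟨.inr x.1, by simp [basicDegree, x.2]⟩
  invFun
    | ⟨.inl _, h⟩ => by simp [basicDegree] at h
    | ⟨.inr x, h⟩ => ⟨x, by simpa [basicDegree] using h⟩
  left_inv _ := rfl
  right_inv
    | ⟨.inl _, h⟩ => by simp [basicDegree] at h
    | ⟨.inr x, h⟩ => rfl

theorem basicDegree_preimage_zero (n : ℕ) : basicDegree (ι := Fin n) ⁻¹' {0} = ∅ := by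
  ext (x | x) <;> simp [basicDegree]

theorem basicDegree_preimage_one (n : ℕ) :
    basicDegree (ι := Fin n) ⁻¹' {1} = Set.range Sum.inl := by
  ext (x | x) <;> simp [basicDegree]

theorem finite_basicDegree_preimage (n k : ℕ) : (basicDegree (ι := Fin n) ⁻¹' {k}).Finite := by
  match k with
  | 0 => simp [basicDegree_preimage_zero]
  | 1 => rw [basicDegree_preimage_one]; exact Set.finite_range _
  | k + 2 =>
    have := finite_basicTriple n k
    exact Set.finite_coe_iff.1 (.of_equiv _ (basicDegreeFiberEquiv n k))

theorem ncard_basicDegree_preimage_one (n : ℕ) :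
    (basicDegree (ι := Fin n) ⁻¹' {1}).ncard = n := by
  rw [basicDegree_preimage_one, ← Set.image_univ, Set.ncard_image_of_injective _ Sum.inl_injective]
  simp

theorem ncard_basicDegree_preimage_add_two (n k : ℕ) :
    (basicDegree (ι := Fin n) ⁻¹' {k + 2}).ncard = (k + 1) * Nat.choose (n + k) (k + 2) := by
  rw [← card_basicTriple, Nat.card_congr (basicDegreeFiberEquiv n k)]
  rfl

end BasicCount

section HomogeneousBasis

variable {R M J : Type*} [CommRing R] [AddCommGroup M] [Module R M] {v : J → M}

theorem isInternal_span_of_linearIndependent (hv : LinearIndependent R v)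
    (hs : Submodule.span R (Set.range v) = ⊤) (d : J → ℕ) :
    DirectSum.IsInternal fun k => Submodule.span R (v '' (d ⁻¹' {k})) := by
  refine DirectSum.isInternal_submodule_of_iSupIndep_of_iSup_eq_top ?_ ?_
  · intro k
    simp only [← Submodule.span_iUnion, ← Set.image_iUnion]
    refine hv.disjoint_span_image (Set.disjoint_left.2 ?_)
    rintro x rfl hx
    simp only [Set.mem_iUnion, Set.mem_preimage, Set.mem_singleton_iff] at hx
    obtain ⟨j, hj, h⟩ := hx
    exact hj h.symm
  · rw [← Submodule.span_iUnion, ← Set.image_iUnion, ← Set.preimage_iUnion, Set.iUnion_of_singleton, Set.preimage_univ,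
      Set.image_univ, hs]

theorem free_span_image (hv : LinearIndependent R v) (s : Set J) :
    Module.Free R (Submodule.span R (v '' s)) := by
  rw [Set.image_eq_range]
  exact .of_basis (Module.Basis.span (hv.comp _ Subtype.val_injective))

theorem finrank_span_image [StrongRankCondition R] (hv : LinearIndependent R v) {s : Set J} :
    Module.finrank R (Submodule.span R (v '' s)) = s.ncard := by
  rw [Set.image_eq_range]
  exact Module.finrank_eq_nat_card_basis (Module.Basis.span (hv.comp _ Subtype.val_injective))

end HomogeneousBasis

section MagnusModel

/-- The metabelian Lie ring of matrices `(f, m; 0, 0)` with `f` in the polynomial ring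
`A = ℤ[t_i]` and `m` a row vector over `A`, with the commutator as bracket. -/
@[ext] structure MagnusLie (ι : Type*) where
  /-- The upper left entry. -/
  scalar : MvPolynomial ι ℤ
  /-- The remaining entries of the first row. -/
  row : ι → MvPolynomial ι ℤ

namespace MagnusLie

variable {ι : Type*}

/-- The additive structure is that of pairs. -/
def toProd (ι : Type*) : MagnusLie ι ≃ MvPolynomial ι ℤ × (ι → MvPolynomial ι ℤ) where
  toFun x := (x.scalar, x.row)
  invFun x := ⟨x.1, x.2⟩
  left_inv _ := rfl
  right_inv _ := rfl

noncomputable instance : AddCommGroup (MagnusLie ι) := (toProd ι).addCommGroup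

@[simp] theorem row_add (x y : MagnusLie ι) : (x + y).row = x.row + y.row := rfl
@[simp] theorem row_zero : (0 : MagnusLie ι).row = 0 := rfl

noncomputable instance : LieRing (MagnusLie ι) where
  bracket x y := ⟨0, x.scalar • y.row - y.scalar • x.row⟩
  add_lie x y z := by
    ext1
    · exact (add_zero 0).symm
    · change (x.scalar + y.scalar) • z.row - z.scalar • (x.row + y.row) =
        (x.scalar • z.row - z.scalar • x.row) + (y.scalar • z.row - z.scalar • y.row)
      module
  lie_add x y z := by
    ext1
    · exact (add_zero 0).symm
    · change x.scalar • (y.row + z.row) - (y.scalar + z.scalar) • x.row =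
        (x.scalar • y.row - y.scalar • x.row) + (x.scalar • z.row - z.scalar • x.row)
      module
  lie_self x := by
    ext1
    · rfl
    · exact sub_self _
  leibniz_lie x y z := by
    ext1
    · exact (add_zero 0).symm
    · change x.scalar • (y.scalar • z.row - z.scalar • y.row) -
          (0 : MvPolynomial ι ℤ) • x.row =
        ((0 : MvPolynomial ι ℤ) • z.row - z.scalar • (x.scalar • y.row - y.scalar • x.row)) +
        (y.scalar • (x.scalar • z.row - z.scalar • x.row) - (0 : MvPolynomial ι ℤ) • y.row)
      module

@[simp] theorem scalar_lie (x y : MagnusLie ι) : ⁅x, y⁆.scalar = 0 := rfl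

@[simp] theorem row_lie (x y : MagnusLie ι) :
    ⁅x, y⁆.row = x.scalar • y.row - y.scalar • x.row := rfl

theorem lie_lie_lie_eq_zero (a b c d : MagnusLie ι) : ⁅⁅a, b⁆, ⁅c, d⁆⁆ = 0 := by
  ext1
  · rfl
  · rw [row_lie, scalar_lie, scalar_lie, zero_smul, zero_smul, sub_zero, row_zero]

open MvPolynomial

/-- The monomial with exponents given by a multiset. -/
noncomputable def tMonomial [DecidableEq ι] (s : Multiset ι) : MvPolynomial ι ℤ :=
  monomial (Multiset.toFinsupp s) 1

theorem X_mul_tMonomial [DecidableEq ι] (i : ι) (s : Multiset ι) :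
    X i * tMonomial s = tMonomial (i ::ₘ s) := by
  rw [tMonomial, tMonomial, X, monomial_mul, one_mul, ← Multiset.singleton_add, map_add,
    Multiset.toFinsupp_singleton]

theorem coeff_tMonomial [DecidableEq ι] (s u : Multiset ι) :
    coeff (Multiset.toFinsupp s) (tMonomial u) = if u = s then 1 else 0 := by
  rw [tMonomial, coeff_monomial]
  simp

variable [LinearOrder ι]

/-- The image of the `i`-th generator. -/
noncomputable def gen (i : ι) : MagnusLie ι := ⟨X i, Pi.single i (tMonomial 0)⟩

theorem iteratedLie_gen (l : List ι) (u : MagnusLie ι) (hu : u.scalar = 0) :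
    (iteratedLie gen l u).scalar = 0 ∧ (iteratedLie gen l u).row =
      fun j => tMonomial (l : Multiset ι) * u.row j := by
  induction l with
  | nil => simp [hu, tMonomial]
  | cons i l ih =>
    refine ⟨rfl, ?_⟩
    rw [iteratedLie_cons, row_lie, ih.1, ih.2, zero_smul, sub_zero]
    funext j
    rw [Pi.smul_apply, smul_eq_mul, ← mul_assoc, gen, X_mul_tMonomial]
    rfl

theorem row_basicElement (x : BasicTriple ι) (i : ι) :
    (basicElement gen (.inr x)).row i =
      (if i = x.1.2.1 then tMonomial (x.1.1 ::ₘ x.1.2.2) else 0) -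
        if i = x.1.1 then tMonomial (x.1.2.1 ::ₘ x.1.2.2) else 0 := by
  have := (iteratedLie_gen x.1.2.2.toList ⁅gen x.1.1, gen x.1.2.1⁆ rfl).2
  rw [basicElement, this, Multiset.coe_toList]
  simp only [row_lie, gen, Pi.sub_apply, Pi.smul_apply, Pi.single_apply, smul_eq_mul, mul_sub,
    mul_ite, mul_zero, X_mul_tMonomial]
  congr 2
  all_goals
    rw [← X_mul_tMonomial, ← X_mul_tMonomial]
    simp [tMonomial, mul_comm]

/-- The coordinates at which the basic elements are detected. -/
noncomputable def detect : ι ⊕ BasicTriple ι → ι × Multiset ι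
  | .inl i => (i, 0)
  | .inr x => (x.1.2.1, x.1.1 ::ₘ x.1.2.2)

theorem detect_inl (i : ι) : detect (.inl i) = (i, 0) := rfl

theorem detect_inr (x : BasicTriple ι) : detect (.inr x) = (x.1.2.1, x.1.1 ::ₘ x.1.2.2) := rfl

/-- The additive functional reading one coefficient of the row vector. -/
noncomputable def rowCoeff (i : ι) (s : Multiset ι) : MagnusLie ι →+ ℤ where
  toFun x := coeff (Multiset.toFinsupp s) (x.row i)
  map_zero' := by simp
  map_add' := by simp

theorem detect_injective : Function.Injective (detect (ι := ι)) := by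
  rintro (i | ⟨⟨p, j, s⟩, hj, hs⟩) (i' | ⟨⟨p', j', s'⟩, hj', hs'⟩) h
  · simpa [detect] using h
  · simp [detect] at h
  · simp [detect] at h
  · simp only [detect, Prod.mk.injEq] at h
    obtain ⟨rfl, h⟩ := h
    have h₁ : p ≤ p' := by
      have : p' ∈ p ::ₘ s := h ▸ Multiset.mem_cons_self _ _
      rcases Multiset.mem_cons.1 this with e | e
      exacts [e.ge, hs _ e]
    have h₂ : p' ≤ p := by
      have : p ∈ p' ::ₘ s' := h ▸ Multiset.mem_cons_self _ _
      rcases Multiset.mem_cons.1 this with e | e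
      exacts [e.ge, hs' _ e]
    obtain rfl := le_antisymm h₁ h₂
    obtain rfl := (Multiset.cons_inj_right p).1 h
    rfl

theorem rowCoeff_basicElement (a b : ι ⊕ BasicTriple ι) :
    rowCoeff (detect a).1 (detect a).2 (basicElement gen b) = if b = a then 1 else 0 := by
  simp only [← (detect_injective (ι := ι)).eq_iff]
  change coeff _ ((basicElement gen b).row (detect a).1) = _
  rcases b with i | x
  · simp only [basicElement, gen, Pi.single_apply]
    by_cases h : (detect a).1 = i
    · rw [if_pos h, coeff_tMonomial]
      simp [Prod.ext_iff, h, detect_inl]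
    · rw [if_neg h, coeff_zero, if_neg]
      rintro h'
      exact h (by rw [← h']; rfl)
  · have hzero : coeff (Multiset.toFinsupp (detect a).2)
        (if (detect a).1 = x.1.1 then tMonomial (x.1.2.1 ::ₘ x.1.2.2) else 0) = 0 := by
      split_ifs with h
      · rw [coeff_tMonomial, if_neg]
        intro h'
        rcases a with i | ⟨⟨p, j, s⟩, hj, hs⟩
        · simp [detect] at h'
        · obtain ⟨⟨p', j', s'⟩, hj', hs'⟩ := x
          simp only [detect] at h h'
          subst h
          have : p ∈ j' ::ₘ s' := h' ▸ Multiset.mem_cons_self _ _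
          rcases Multiset.mem_cons.1 this with e | e
          · exact absurd (hj.trans hj') (e ▸ lt_irrefl _)
          · exact absurd (hs' _ e) (not_le.2 hj)
      · rw [coeff_zero]
    rw [row_basicElement, coeff_sub, hzero, sub_zero]
    by_cases h : (detect a).1 = x.1.2.1
    · rw [if_pos h, coeff_tMonomial]
      simp [Prod.ext_iff, h, detect_inr]
    · rw [if_neg h, coeff_zero, if_neg]
      rintro h'
      exact h (by rw [← h']; rfl)

end MagnusLie

end MagnusModel

section FreeMetabelian

variable {n : ℕ}

open LieAlgebra

theorem mem_span_lie_of_mem_derivedSeries_one {L : Type*} [LieRing L] {x : L}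
    (hx : x ∈ derivedSeries ℤ L 1) : x ∈ Submodule.span ℤ {z : L | ∃ a b : L, ⁅a, b⁆ = z} := by
  have : derivedSeries ℤ L 1 = ⁅(⊤ : LieIdeal ℤ L), (⊤ : LieIdeal ℤ L)⁆ := rfl
  rw [this, ← LieSubmodule.mem_toSubmodule, LieSubmodule.lieIdeal_oper_eq_linear_span'] at hx
  simpa using hx

theorem map_eq_zero_of_mem_derivedSeries_two {L E : Type*} [LieRing L] [LieRing E]
    (hE : ∀ a b c d : E, ⁅⁅a, b⁆, ⁅c, d⁆⁆ = 0) (ψ : L →ₗ⁅ℤ⁆ E) {x : L}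
    (hx : x ∈ derivedSeries ℤ L 2) : ψ x = 0 := by
  have h : derivedSeries ℤ L 2 = ⁅derivedSeries ℤ L 1, derivedSeries ℤ L 1⁆ := rfl
  rw [h, ← LieSubmodule.mem_toSubmodule, LieSubmodule.lieIdeal_oper_eq_linear_span'] at hx
  induction hx using Submodule.span_induction with
  | zero => exact map_zero _
  | add _ _ _ _ h₁ h₂ => rw [map_add, h₁, h₂, add_zero]
  | smul c _ _ h₁ => rw [map_smul, h₁, smul_zero]
  | mem x hx =>
    obtain ⟨u, hu, w, hw, rfl⟩ := hx
    rw [LieHom.map_lie]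
    replace hu := mem_span_lie_of_mem_derivedSeries_one hu
    replace hw := mem_span_lie_of_mem_derivedSeries_one hw
    induction hu using Submodule.span_induction with
    | zero => simp
    | add _ _ _ _ h₁ h₂ => rw [map_add, add_lie, h₁, h₂, add_zero]
    | smul c _ _ h₁ => rw [map_smul, smul_lie, h₁, smul_zero]
    | mem u hu =>
    induction hw using Submodule.span_induction with
    | zero => simp
    | add _ _ _ _ h₁ h₂ => rw [map_add, lie_add, h₁, h₂, add_zero]
    | smul c _ _ h₁ => rw [map_smul, lie_smul, h₁, smul_zero]
    | mem w hw =>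
      obtain ⟨a, b, rfl⟩ := hu
      obtain ⟨c, d, rfl⟩ := hw
      simp only [LieHom.map_lie, hE]

/-- The image of the `i`-th generator in the free metabelian Lie algebra. -/
noncomputable def metabelianGen (i : Fin n) : FreeMetabelianLie n :=
  LieSubmodule.Quotient.mk (FreeLieAlgebra.of ℤ i)

theorem exists_freeMetabelianLie_hom {E : Type*} [LieRing E]
    (hE : ∀ a b c d : E, ⁅⁅a, b⁆, ⁅c, d⁆⁆ = 0) (z : Fin n → E) :
    ∃ Φ : FreeMetabelianLie n →+ E, (∀ i, Φ (metabelianGen i) = z i) ∧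
      ∀ a b : FreeMetabelianLie n, Φ ⁅a, b⁆ = ⁅Φ a, Φ b⁆ := by
  let ψ : FreeLieAlgebra ℤ (Fin n) →ₗ⁅ℤ⁆ E := FreeLieAlgebra.lift ℤ z
  refine ⟨(Submodule.liftQ _ (ψ : FreeLieAlgebra ℤ (Fin n) →ₗ[ℤ] E)
    fun x hx => map_eq_zero_of_mem_derivedSeries_two hE ψ hx).toAddMonoidHom,
    fun i => FreeLieAlgebra.lift_of_apply z i, ?_⟩
  rintro ⟨a⟩ ⟨b⟩
  exact LieHom.map_lie ψ a b

theorem freeMetabelianLie_lie_lie_lie (a b c d : FreeMetabelianLie n) :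
    ⁅⁅a, b⁆, ⁅c, d⁆⁆ = 0 := by
  induction a using Submodule.Quotient.induction_on with | _ a
  induction b using Submodule.Quotient.induction_on with | _ b
  induction c using Submodule.Quotient.induction_on with | _ c
  induction d using Submodule.Quotient.induction_on with | _ d
  refine (LieSubmodule.Quotient.mk_eq_zero' (N := derivedSeries ℤ (FreeLieAlgebra ℤ (Fin n)) 2)
    (m := ⁅⁅a, b⁆, ⁅c, d⁆⁆)).2 ?_
  exact LieSubmodule.lie_mem_lie
    (LieSubmodule.lie_mem_lie (LieSubmodule.mem_top a) (LieSubmodule.mem_top b))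
    (LieSubmodule.lie_mem_lie (LieSubmodule.mem_top c) (LieSubmodule.mem_top d))

theorem map_basicElement {ι L E : Type*} [LinearOrder ι] [LieRing L] [LieRing E] (y : ι → L)
    (Φ : L →+ E) (hΦ : ∀ a b : L, Φ ⁅a, b⁆ = ⁅Φ a, Φ b⁆) (x : ι ⊕ BasicTriple ι) :
    Φ (basicElement y x) = basicElement (fun i => Φ (y i)) x := by
  have h : ∀ (l : List ι) (u : L), Φ (iteratedLie y l u) =
      iteratedLie (fun i => Φ (y i)) l (Φ u) := by
    intro l u
    induction l with
    | nil => rfl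
    | cons i l ih => rw [iteratedLie_cons, hΦ, ih, iteratedLie_cons]
  rcases x with i | x
  · rfl
  · rw [basicElement, h, hΦ, basicElement]

theorem linearIndependent_basicElement :
    LinearIndependent ℤ (basicElement (metabelianGen (n := n))) := by
  obtain ⟨Φ, hgen, hlie⟩ := exists_freeMetabelianLie_hom (n := n)
    MagnusLie.lie_lie_lie_eq_zero MagnusLie.gen
  have key : ∀ a b, MagnusLie.rowCoeff (MagnusLie.detect a).1 (MagnusLie.detect a).2
      (Φ (basicElement metabelianGen b)) = if b = a then 1 else 0 := by
    intro a b
    rw [map_basicElement _ Φ hlie, funext hgen, MagnusLie.rowCoeff_basicElement]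
  refine LinearIndependent.of_pairwise_dual_eq_zero_one _ (fun a =>
    ((MagnusLie.rowCoeff (MagnusLie.detect a).1 (MagnusLie.detect a).2).comp Φ).toIntLinearMap)
    (fun a b hab => ?_) fun a => ?_
  · exact (key a b).trans (if_neg hab.symm)
  · exact (key a a).trans (if_pos rfl)

/-- The bracket monomials span the free Lie algebra. -/
theorem mem_span_isBracketMonomial (x : FreeLieAlgebra ℤ (Fin n)) :
    x ∈ Submodule.span ℤ {z | ∃ k, IsBracketMonomial n k z} := by
  let S : LieSubalgebra ℤ (FreeLieAlgebra ℤ (Fin n)) :=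
    { Submodule.span ℤ {z | ∃ k, IsBracketMonomial n k z} with
      lie_mem' := by
        intro u w hu hw
        change u ∈ Submodule.span ℤ _ at hu
        change w ∈ Submodule.span ℤ _ at hw
        change ⁅u, w⁆ ∈ Submodule.span ℤ _
        induction hu using Submodule.span_induction with
        | zero => rw [zero_lie]; exact zero_mem _
        | add _ _ _ _ h₁ h₂ => rw [add_lie]; exact add_mem h₁ h₂
        | smul c _ _ h₁ => rw [smul_lie]; exact Submodule.smul_mem _ c h₁
        | mem u hu =>
        induction hw using Submodule.span_induction with
        | zero => rw [lie_zero]; exact zero_mem _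
        | add _ _ _ _ h₁ h₂ => rw [lie_add]; exact add_mem h₁ h₂
        | smul c _ _ h₁ => rw [lie_smul]; exact Submodule.smul_mem _ c h₁
        | mem w hw =>
          obtain ⟨k, hk⟩ := hu
          obtain ⟨l, hl⟩ := hw
          exact Submodule.subset_span ⟨_, hk.lie hl⟩ }
  let ψ : FreeLieAlgebra ℤ (Fin n) →ₗ⁅ℤ⁆ S := FreeLieAlgebra.lift ℤ fun i =>
    ⟨FreeLieAlgebra.of ℤ i, Submodule.subset_span ⟨1, .of i⟩⟩
  have hψ : S.incl.comp ψ = LieHom.id := by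
    apply FreeLieAlgebra.hom_ext
    intro i
    change ((ψ (FreeLieAlgebra.of ℤ i) : S) : FreeLieAlgebra ℤ (Fin n)) = _
    rw [show ψ (FreeLieAlgebra.of ℤ i) = _ from FreeLieAlgebra.lift_of_apply _ i]
    rfl
  have hx : S.incl (ψ x) = x := congrArg (fun f => f x) hψ
  rw [← hx]
  exact (ψ x).2

theorem exists_isBracketMonomial_basicElement (x : Fin n ⊕ BasicTriple (Fin n)) :
    ∃ z, IsBracketMonomial n (basicDegree x) z ∧
      (LieSubmodule.Quotient.mk z : FreeMetabelianLie n) = basicElement metabelianGen x := by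
  have h : ∀ (l : List (Fin n)) (z : FreeLieAlgebra ℤ (Fin n)) (k : ℕ), IsBracketMonomial n k z →
      ∃ w, IsBracketMonomial n (l.length + k) w ∧
        (LieSubmodule.Quotient.mk w : FreeMetabelianLie n) =
          iteratedLie metabelianGen l (LieSubmodule.Quotient.mk z : FreeMetabelianLie n) := by
    intro l z k hz
    induction l with
    | nil => exact ⟨z, by simpa using hz, rfl⟩
    | cons i l ih =>
      obtain ⟨w, hw, hw'⟩ := ih
      refine ⟨⁅FreeLieAlgebra.of ℤ i, w⁆, ?_, ?_⟩
      · rw [List.length_cons, Nat.add_right_comm, Nat.add_comm]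
        exact (IsBracketMonomial.of i).lie hw
      · rw [iteratedLie_cons, ← hw']
        rfl
  rcases x with i | x
  · exact ⟨_, .of i, rfl⟩
  · obtain ⟨w, hw, hw'⟩ := h x.1.2.2.toList _ _
      ((IsBracketMonomial.of x.1.1).lie (IsBracketMonomial.of x.1.2.1))
    refine ⟨w, ?_, hw'⟩
    rwa [Multiset.length_toList] at hw

theorem mk_mem_basicSpan {k : ℕ} {z : FreeLieAlgebra ℤ (Fin n)} (hz : IsBracketMonomial n k z) :
    (LieSubmodule.Quotient.mk z : FreeMetabelianLie n) ∈ basicSpan metabelianGen k := by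
  induction hz with
  | of i => exact basicElement_mem_basicSpan metabelianGen (.inl i)
  | lie _ _ h₁ h₂ => exact lie_mem_basicSpan freeMetabelianLie_lie_lie_lie h₁ h₂

theorem freeMetabelianDegree_eq_span (k : ℕ) :
    freeMetabelianDegree n k =
      Submodule.span ℤ (basicElement metabelianGen '' (basicDegree ⁻¹' {k})) := by
  have hmap : freeMetabelianDegree n k = Submodule.span ℤ
      ((fun z => (LieSubmodule.Quotient.mk z : FreeMetabelianLie n)) ''
        {z | IsBracketMonomial n k z}) :=
    Submodule.map_span _ _
  rw [hmap]
  refine le_antisymm (Submodule.span_le.2 ?_) (Submodule.span_mono ?_)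
  · rintro _ ⟨z, hz, rfl⟩
    have := mk_mem_basicSpan hz
    rw [basicSpan, ← Submodule.span_int_eq_addSubgroupClosure] at this
    exact this
  · rintro _ ⟨x, rfl, rfl⟩
    exact exists_isBracketMonomial_basicElement x

theorem span_range_basicElement :
    Submodule.span ℤ (Set.range (basicElement (metabelianGen (n := n)))) = ⊤ := by
  rw [eq_top_iff]
  rintro ⟨x⟩ -
  change (LieSubmodule.Quotient.mk x : FreeMetabelianLie n) ∈ _
  have hx := mem_span_isBracketMonomial x
  induction hx using Submodule.span_induction with
  | zero => exact zero_mem _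
  | add _ _ _ _ h₁ h₂ => exact add_mem h₁ h₂
  | smul c _ _ h₁ => exact Submodule.smul_mem _ c h₁
  | mem z hz =>
    obtain ⟨k, hk⟩ := hz
    have := mk_mem_basicSpan hk
    rw [basicSpan, ← Submodule.span_int_eq_addSubgroupClosure] at this
    exact Submodule.span_mono (Set.image_subset_range _ _) this

end FreeMetabelian

theorem corollary4p4 (n : ℕ) :
    Module.Free ℤ (FreeMetabelianLie n) ∧
    DirectSum.IsInternal (freeMetabelianDegree n) ∧
    (∀ k : ℕ, Module.Free ℤ (freeMetabelianDegree n k) ∧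
      Module.Finite ℤ (freeMetabelianDegree n k)) ∧
    hilbertSeries (freeMetabelianDegree n) =
      (n : PowerSeries ℤ) * PowerSeries.X +
        PowerSeries.mk (fun k : ℕ =>
          if 2 ≤ k then ((k : ℤ) - 1) * (Nat.choose (n + k - 2) k : ℤ) else 0) := by
  have hli := linearIndependent_basicElement (n := n)
  have hspan := span_range_basicElement (n := n)
  refine ⟨.of_basis (Module.Basis.mk hli hspan.ge), ?_, fun k => ⟨?_, ?_⟩, ?_⟩
  · rw [funext (freeMetabelianDegree_eq_span (n := n))]
    exact isInternal_span_of_linearIndependent hli hspan basicDegree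
  · rw [freeMetabelianDegree_eq_span]
    exact free_span_image hli _
  · rw [freeMetabelianDegree_eq_span]
    exact Module.Finite.span_of_finite ℤ ((finite_basicDegree_preimage n k).image _)
  · ext k
    have hn : (n : PowerSeries ℤ) = PowerSeries.C (n : ℤ) := by simp
    rw [hilbertSeries, PowerSeries.coeff_mk, freeMetabelianDegree_eq_span, finrank_span_image hli,
      map_add, PowerSeries.coeff_mk, hn, PowerSeries.coeff_C_mul, PowerSeries.coeff_X]
    match k with
    | 0 => simp [basicDegree_preimage_zero]
    | 1 => simp [ncard_basicDegree_preimage_one]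
    | k + 2 =>
      rw [ncard_basicDegree_preimage_add_two, if_neg (by omega), if_pos (by omega),
        show n + (k + 2) - 2 = n + k by omega]
      push_cast
      ring
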